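/- Let $\zeta,\phi_1,\phi_2,X,Y$ be independent, where $\zeta$ is Gamma distributed with density $m^m u^{m-1}e^{-mu}/\Gamma(m)$, $u>0$ (real $m>0$), $\phi_1,\phi_2$ are uniform on $[0,2\pi)$, and $X,Y\sim\mathcal N(0,\sigma^2)$ with $\sigma>0$. For constants $V_1,V_2\ge 0$ put $$V=\sqrt{\zeta}\,V_1e^{j\phi_1}+\sqrt{\zeta}\,V_2e^{j\phi_2}+X+jY,\qquad K=\frac{V_1^2+V_2^2}{2\sigma^2},\qquad \Delta=\frac{2V_1V_2}{V_1^2+V_2^2}\in[0,1]$$ (if $V_1=V_2=0$, any $\Delta\in[0,1]$ is allowed). A random variable $\gamma$ with the law of $|V|^2$ and mean $\bar\gamma=\mathbb E|V|^2$ is said to have the fluctuating two-ray distribution, $\gamma\sim\mathcal{FTR}(\bar\gamma,m,K,\Delta)$. Let $\gamma\sim\mathcal{FTR}(\bar\gamma,m,K,\Delta)$, let $n\ge 0$ be an integer and let $s\in\mathbb C$ satisfy $(m+K+K\Delta)\,\bar\gamma\,\operatorname{Re}s<m(1+K)$ (in particular, $s$ may be any non-positive real number). Then $\gamma^ne^{s\gamma}$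 is integrable, and the generalized moment generating function $M_\gamma^{(n)}(s)=\mathbb E[\gamma^ne^{s\gamma}]$ is $$M_\gamma^{(n)}(s)=n!\,m^m(1+K-\bar\gamma s)^{m-n-1}\,\bar\gamma^{\,n}\sum_{l=0}^n\binom nl\frac{(m)_l}{l!}\,\frac{(1+K)^{l+1}K^l}{\left[m(1+K)-(m+K-K\Delta)\bar\gamma s\right]^{m+l}}$$ $$\times\sum_{q=0}^l\binom lq(1-\Delta)^{l-q}(2\Delta)^q\,\frac{\Gamma(\frac12+q)}{\sqrt\pi\,\Gamma(q+1)}\;{}_2F_1\!\left(m+l,\tfrac12+q;q+1;\frac{2K\Delta\bar\gamma s}{m(1+K)-(m+K-K\Delta)\bar\gamma s}\right),$$ where $(m)_l=m(m+1)\cdots(m+l-1)$, $0^0=1$, powers are principal values, and ${}_2F_1$ is the Gauss hypergeometric function on $\mathbb C\setminus[1,\infty)$, that is, the analytic continuation of the hypergeometric series from the unit disc. -/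

import Mathlib

open MeasureTheory ProbabilityTheory

/-! ### The Gauss hypergeometric function on the plane cut along `[1, ∞)` -/

/-- `F` is the analytic continuation of the Gauss hypergeometric series
`∑ (a)ₖ (b)ₖ / ((c)ₖ k!) zᵏ` from the open unit disc to the cut plane `ℂ \ [1, ∞)`. -/
def IsGaussHypergeometric (a b c : ℂ) (F : ℂ → ℂ) : Prop :=
  DifferentiableOn ℂ F {z : ℂ | 1 - z ∈ Complex.slitPlane} ∧
    ∀ z : ℂ, ‖z‖ < 1 → F z = ordinaryHypergeometric a b c z

open Classical in
/-- The Gauss hypergeometric function `₂F₁(a, b; c; z)` (principal branch): the sum of the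
hypergeometric series for `‖z‖ < 1`, and its analytic continuation elsewhere in `ℂ \ [1, ∞)`.
(Mathlib's `ordinaryHypergeometric` is only the sum of the series.) -/
noncomputable def gaussHypergeometric (a b c z : ℂ) : ℂ :=
  if h : ∃ F : ℂ → ℂ, IsGaussHypergeometric a b c F then h.choose z else 0

/-- The continuation is unique, so the choice in `gaussHypergeometric` is immaterial. -/
theorem gaussHypergeometric_eq {a b c : ℂ} {F : ℂ → ℂ} (hF : IsGaussHypergeometric a b c F)
    {z : ℂ} (hz : 1 - z ∈ Complex.slitPlane) : gaussHypergeometric a b c z = F z := by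
  have h : ∃ F : ℂ → ℂ, IsGaussHypergeometric a b c F := ⟨F, hF⟩
  have hG := h.choose_spec
  rw [gaussHypergeometric, dif_pos h]
  have hopen : IsOpen {z : ℂ | 1 - z ∈ Complex.slitPlane} :=
    Complex.isOpen_slitPlane.preimage (continuous_const.sub continuous_id)
  have hconn : IsPreconnected {z : ℂ | 1 - z ∈ Complex.slitPlane} := by
    have h1 : IsPreconnected Complex.slitPlane :=
      (Complex.starConvex_one_slitPlane.isPathConnected Complex.one_mem_slitPlane).isConnected.isPreconnected
    have h2 := h1.image (fun w : ℂ => 1 - w) (by fun_prop)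
    convert h2 using 1
    ext w
    simp only [Set.mem_ofPred_eq, Set.mem_image]
    exact ⟨fun hw => ⟨1 - w, hw, by ring⟩, fun ⟨v, hv, hvw⟩ => by rw [← hvw]; simpa using hv⟩
  have h0 : (0 : ℂ) ∈ {z : ℂ | 1 - z ∈ Complex.slitPlane} := by simp
  refine (hG.1.analyticOnNhd hopen).eqOn_of_preconnected_of_eventuallyEq
    (hF.1.analyticOnNhd hopen) hconn h0 ?_ hz
  filter_upwards [Metric.ball_mem_nhds (0 : ℂ) one_pos] with w hw
  have hw' : ‖w‖ < 1 := by simpa using hw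
  rw [hG.2 w hw', hF.2 w hw']

/-! ### The fluctuating two-ray (FTR) distribution -/

/-- The received complex baseband signal
`√ζ V₁ exp(j φ₁) + √ζ V₂ exp(j φ₂) + X + j Y` of the two-ray channel. -/
noncomputable def receivedSignal (V₁ V₂ ζ φ₁ φ₂ X Y : ℝ) : ℂ :=
  (Real.sqrt ζ : ℂ) * V₁ * Complex.exp (Complex.I * φ₁)
    + (Real.sqrt ζ : ℂ) * V₂ * Complex.exp (Complex.I * φ₂) + (X + Complex.I * Y)

/-- The uniform distribution on `[0, 2π)`. -/
noncomputable def uniformPhase : Measure ℝ :=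
  cond volume (Set.Ico 0 (2 * Real.pi))

/-- The law of `|V|²`, where `V = √ζ V₁ exp(j φ₁) + √ζ V₂ exp(j φ₂) + X + j Y` and
`ζ, φ₁, φ₂, X, Y` are independent: `ζ` has the unit-mean Gamma law with density
`mᵐ uᵐ⁻¹ e^{-mu} / Γ(m)`, the phases `φ₁, φ₂` are uniform on `[0, 2π)`, and
`X, Y` are centred Gaussian of variance `σ²`. -/
noncomputable def envelopePowerLaw (m V₁ V₂ σ : ℝ) : Measure ℝ :=
  ((gammaMeasure m m).prod (uniformPhase.prod (uniformPhase.prod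
    ((gaussianReal 0 (σ ^ 2).toNNReal).prod (gaussianReal 0 (σ ^ 2).toNNReal))))).map
    (fun p : ℝ × ℝ × ℝ × ℝ × ℝ =>
      ‖receivedSignal V₁ V₂ p.1 p.2.1 p.2.2.1 p.2.2.2.1 p.2.2.2.2‖ ^ 2)

/-- `γ ∼ FTR(γbar, m, K, Δ)`: `γ` is distributed as the envelope power `|V|²` of a two-ray channel
with amplitudes `V₁, V₂ ≥ 0`, diffuse power `2σ² > 0` and Gamma shape `m > 0`, where
`K = (V₁² + V₂²) / (2σ²)`, `Δ = 2 V₁ V₂ / (V₁² + V₂²)`, and `γbar` is the mean.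
If `V₁ = V₂ = 0` (that is, `K = 0`) the quotient is undefined and any `Δ ∈ [0, 1]` is allowed. -/
def IsFTR {Ω : Type*} [MeasurableSpace Ω] (γ : Ω → ℝ) (γbar m K Δ : ℝ) (P : Measure Ω) : Prop :=
  0 < m ∧ 0 ≤ Δ ∧ Δ ≤ 1 ∧
    ∃ V₁ V₂ σ : ℝ, 0 ≤ V₁ ∧ 0 ≤ V₂ ∧ 0 < σ ∧
      K = (V₁ ^ 2 + V₂ ^ 2) / (2 * σ ^ 2) ∧
      Δ * (V₁ ^ 2 + V₂ ^ 2) = 2 * V₁ * V₂ ∧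
      γbar = ∫ x, x ∂(envelopePowerLaw m V₁ V₂ σ) ∧
      HasLaw γ (envelopePowerLaw m V₁ V₂ σ) P

/-- The generalized moment generating function `M⁽ⁿ⁾(s) = E[γⁿ e^{sγ}]`. -/
noncomputable def gmgf {Ω : Type*} [MeasurableSpace Ω] (γ : Ω → ℝ) (P : Measure Ω) (n : ℕ)
    (s : ℂ) : ℂ :=
  ∫ ω, (γ ω : ℂ) ^ n * Complex.exp (s * γ ω) ∂P

/-
Given the phases, `|V|²` is a Rician-shadowed power whose specular-to-diffuse ratio `k` depends on
them. With `w = 2σ²`, integrating out the Gaussian and then the Gamma variables shows that its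
moment generating function is `mᵐ (1 - w s)ᵐ⁻¹ E⁻ᵐ`, `E = m - (m + k) w s`, for real `s`, hence
for complex `s` by the identity theorem. Since `(m + k) (1 - w s) = E + k`, its `n`-th derivative
is again a combination, with binomial weights, of the products `kˡ E⁻⁽ᵐ⁺ˡ⁾`, `l ≤ n`.

The ratio `k = K (1 - Δ + 2 Δ T)` is affine in `T = (1 + cos (φ₁ - φ₂)) / 2`, which has the arcsine
law on `[0, 1]`. Averaging `kˡ E⁻⁽ᵐ⁺ˡ⁾` over the phases therefore produces the integrals
`E[T^q (1 - z T)⁻⁽ᵐ⁺ˡ⁾]`. These are holomorphic in `z` off `[1, ∞)`, and the moments of `T`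
identify their power series at `0` as hypergeometric.
-/

section EulerIntegral

theorem one_sub_mul_mem_slitPlane {z : ℂ} (hz : 1 - z ∈ Complex.slitPlane) {t : ℝ}
    (ht : t ∈ Set.Icc 0 1) : 1 - z * t ∈ Complex.slitPlane := by
  convert Complex.starConvex_one_slitPlane hz (sub_nonneg.2 ht.2) ht.1 (sub_add_cancel 1 t) using 1
  simp only [Complex.real_smul, Complex.ofReal_sub, Complex.ofReal_one]
  ring

theorem isOpen_one_sub_mem_slitPlane : IsOpen {z : ℂ | 1 - z ∈ Complex.slitPlane} :=
  Complex.isOpen_slitPlane.preimage (continuous_const.sub continuous_id)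

theorem hasSum_one_sub_cpow_neg (a : ℂ) {x : ℂ} (hx : ‖x‖ < 1) :
    HasSum (fun k : ℕ => (k.factorial : ℂ)⁻¹ * (ascPochhammer ℂ k).eval a * x ^ k)
      ((1 - x) ^ (-a)) := by
  have h := (Complex.one_div_one_sub_cpow_hasFPowerSeriesOnBall_zero a).hasSum (y := x)
    (by simpa [← ofReal_norm] using hx)
  rw [zero_add, one_div, ← Complex.cpow_neg] at h
  refine h.congr_fun fun k => ?_
  rw [FormalMultilinearSeries.ofScalars_apply_eq, smul_eq_mul, ← Ring.multichoose_eq,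
    ← Polynomial.ascPochhammer_smeval_eq_eval, ← Ring.factorial_nsmul_multichoose_eq_ascPochhammer,
    nsmul_eq_mul, inv_mul_cancel_left₀ (Nat.cast_ne_zero.2 k.factorial_ne_zero)]

variable {Ω : Type*} [MeasurableSpace Ω] {ν : Measure Ω} {T : Ω → ℝ} {g : Ω → ℂ}

theorem continuousOn_one_sub_mul_cpow (a : ℂ) :
    ContinuousOn (fun p : ℂ × ℝ => (1 - p.1 * p.2) ^ a)
      ({z : ℂ | 1 - z ∈ Complex.slitPlane} ×ˢ Set.Icc 0 1) :=
  ContinuousOn.cpow (by fun_prop) continuousOn_const fun _ hp =>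
    one_sub_mul_mem_slitPlane hp.1 hp.2

theorem aestronglyMeasurable_one_sub_mul_cpow (hT : Measurable T) (hg : AEStronglyMeasurable g ν)
    (a z : ℂ) : AEStronglyMeasurable (fun ω => g ω * (1 - z * T ω) ^ a) ν :=
  hg.mul (by fun_prop : Measurable fun ω => (1 - z * T ω : ℂ) ^ a).aestronglyMeasurable

theorem integrable_mul_one_sub_mul_cpow (hT : Measurable T) (hT01 : ∀ ω, T ω ∈ Set.Icc 0 1)
    (hg : Integrable g ν) (a : ℂ) {z : ℂ} (hz : 1 - z ∈ Complex.slitPlane) :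
    Integrable (fun ω => g ω * (1 - z * T ω) ^ a) ν := by
  have hcont : ContinuousOn (fun t : ℝ => (1 - z * t : ℂ) ^ a) (Set.Icc 0 1) :=
    (continuousOn_one_sub_mul_cpow a).comp (f := fun t : ℝ => (z, t)) (by fun_prop)
      fun t ht => ⟨hz, ht⟩
  obtain ⟨C, hC⟩ := isCompact_Icc.exists_bound_of_continuousOn hcont
  exact hg.mul_bdd (c := C)
    (by fun_prop : Measurable fun ω => (1 - z * T ω : ℂ) ^ a).aestronglyMeasurable
    (.of_forall fun ω => hC _ (hT01 ω))

theorem hasDerivAt_one_sub_mul_cpow (a : ℂ) {z : ℂ} (hz : 1 - z ∈ Complex.slitPlane) {t : ℝ}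
    (ht : t ∈ Set.Icc 0 1) :
    HasDerivAt (fun w : ℂ => (1 - w * t) ^ a) (a * (1 - z * t) ^ (a - 1) * -t) z := by
  have h : HasDerivAt (fun w : ℂ => 1 - w * t) (-t) z := by
    simpa only [id, one_mul] using ((hasDerivAt_id z).mul_const (t : ℂ)).const_sub 1
  exact h.cpow_const (one_sub_mul_mem_slitPlane hz ht)

theorem differentiableOn_integral_mul_one_sub_mul_cpow (hT : Measurable T)
    (hT01 : ∀ ω, T ω ∈ Set.Icc 0 1) (hg : Integrable g ν) (a : ℂ) :
    DifferentiableOn ℂ (fun z => ∫ ω, g ω * (1 - z * T ω) ^ a ∂ν)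
      {z : ℂ | 1 - z ∈ Complex.slitPlane} := by
  intro z hz
  obtain ⟨ε, hε, hball⟩ :=
    Metric.nhds_basis_closedBall.mem_iff.1 (isOpen_one_sub_mem_slitPlane.mem_nhds hz)
  obtain ⟨C, hC⟩ := ((isCompact_closedBall z ε).prod isCompact_Icc).exists_bound_of_continuousOn
    (f := fun p : ℂ × ℝ => a * (1 - p.1 * p.2) ^ (a - 1) * -p.2)
    (((continuousOn_one_sub_mul_cpow (a - 1)).mono
      (Set.prod_mono hball subset_rfl)).const_mul a |>.mul (by fun_prop))
  refine (hasDerivAt_integral_of_dominated_loc_of_deriv_le (bound := fun ω => ‖g ω‖ * C)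
    (F' := fun w ω => g ω * (a * (1 - w * T ω) ^ (a - 1) * -T ω))
    (Metric.closedBall_mem_nhds z hε)
    (.of_forall fun w => aestronglyMeasurable_one_sub_mul_cpow hT hg.1 a w)
    (integrable_mul_one_sub_mul_cpow hT hT01 hg a hz) ?_
    (.of_forall fun ω w hw => ?_) (hg.norm.mul_const C) (.of_forall fun ω w hw => ?_)
    ).2.differentiableAt.differentiableWithinAt
  · exact hg.1.mul (by fun_prop :
      Measurable fun ω => a * (1 - z * T ω : ℂ) ^ (a - 1) * -T ω).aestronglyMeasurable
  · rw [norm_mul]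
    gcongr
    exact hC (w, T ω) ⟨hw, hT01 ω⟩
  · exact (hasDerivAt_one_sub_mul_cpow a (hball hw) (hT01 ω)).const_mul (g ω)

theorem hasSum_integral_mul_one_sub_mul_cpow (hT : Measurable T)
    (hT01 : ∀ ω, T ω ∈ Set.Icc 0 1) (hg : Integrable g ν) (a : ℂ) {z : ℂ} (hz : ‖z‖ < 1) :
    HasSum (fun k : ℕ => (k.factorial : ℂ)⁻¹ * (ascPochhammer ℂ k).eval a * z ^ k
      * ∫ ω, g ω * T ω ^ k ∂ν) (∫ ω, g ω * (1 - z * T ω) ^ (-a) ∂ν) := by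
  simp_rw [← integral_const_mul]
  have hnorm (ω) : ‖(T ω : ℂ)‖ ≤ 1 := by
    rw [Complex.norm_real, Real.norm_of_nonneg (hT01 ω).1]
    exact (hT01 ω).2
  have hsum : Summable fun k : ℕ =>
      ‖(k.factorial : ℂ)⁻¹ * (ascPochhammer ℂ k).eval a * (‖z‖ : ℂ) ^ k‖ :=
    (hasSum_one_sub_cpow_neg a (x := (‖z‖ : ℂ)) (by simpa using hz)).summable.norm
  refine hasSum_integral_of_dominated_convergence
    (fun k ω => ‖(k.factorial : ℂ)⁻¹ * (ascPochhammer ℂ k).eval a * (‖z‖ : ℂ) ^ k‖ * ‖g ω‖)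
    (fun k => ?_) (fun k => .of_forall fun ω => ?_) (.of_forall fun ω => hsum.mul_right _) ?_
    (.of_forall fun ω => ?_)
  · exact (hg.1.mul (by fun_prop : Measurable fun ω =>
      (T ω : ℂ) ^ k).aestronglyMeasurable).const_mul _
  · simp only [norm_mul, norm_pow, Complex.norm_real, norm_norm, mul_assoc]
    gcongr
    exact mul_le_of_le_one_right (norm_nonneg _)
      (pow_le_one₀ (norm_nonneg _) (by simpa using hnorm ω))
  · simpa only [tsum_mul_right] using hg.norm.const_mul _
  · have hzT : ‖z * T ω‖ < 1 := by
      rw [norm_mul]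
      exact (mul_le_of_le_one_right (norm_nonneg _) (hnorm ω)).trans_lt hz
    refine ((hasSum_one_sub_cpow_neg a hzT).mul_left (g ω)).congr_fun fun k => ?_
    ring

theorem isGaussHypergeometric_integral {b c : ℂ} (hT : Measurable T)
    (hT01 : ∀ ω, T ω ∈ Set.Icc 0 1) (hg : Integrable g ν)
    (hmom : ∀ k : ℕ, ∫ ω, g ω * T ω ^ k ∂ν
      = (ascPochhammer ℂ k).eval b / (ascPochhammer ℂ k).eval c) (a : ℂ) :
    IsGaussHypergeometric a b c fun z => ∫ ω, g ω * (1 - z * T ω) ^ (-a) ∂ν := by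
  refine ⟨differentiableOn_integral_mul_one_sub_mul_cpow hT hT01 hg (-a), fun z hz => ?_⟩
  beta_reduce
  rw [ordinaryHypergeometric_eq_tsum,
    ← (hasSum_integral_mul_one_sub_mul_cpow hT hT01 hg a hz).tsum_eq]
  refine tsum_congr fun k => ?_
  rw [hmom, smul_eq_mul]
  ring

end EulerIntegral

section PhaseDifference

/-- The `k`-th moment of the arcsine law on `[0, 1]`, the law of `phaseAlignment` for independent
uniform phases. -/
noncomputable def arcsineMoment (k : ℕ) : ℝ :=
  Real.Gamma (1 / 2 + k) / (Real.sqrt Real.pi * Real.Gamma (k + 1))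

theorem arcsineMoment_pos (k : ℕ) : 0 < arcsineMoment k :=
  div_pos (Real.Gamma_pos_of_pos (by positivity))
    (mul_pos (by positivity) (Real.Gamma_pos_of_pos (by positivity)))

theorem arcsineMoment_zero : arcsineMoment 0 = 1 := by
  rw [arcsineMoment, Nat.cast_zero, add_zero, zero_add, Real.Gamma_one, mul_one,
    Real.Gamma_one_half_eq, div_self (Real.sqrt_pos.2 Real.pi_pos).ne']

theorem arcsineMoment_succ (k : ℕ) :
    arcsineMoment (k + 1) = arcsineMoment k * ((1 / 2 + k) / (k + 1)) := by
  rw [arcsineMoment, arcsineMoment, Nat.cast_add_one, ← add_assoc,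
    Real.Gamma_add_one (by positivity), Real.Gamma_add_one (by positivity : (k + 1 : ℝ) ≠ 0),
    div_mul_div_comm]
  ring

theorem arcsineMoment_eq_prod (k : ℕ) :
    arcsineMoment k = ∏ i ∈ Finset.range k, (2 * (i : ℝ) + 1) / (2 * i + 2) := by
  induction k with
  | zero => rw [arcsineMoment_zero, Finset.prod_range_zero]
  | succ k ih =>
    rw [arcsineMoment_succ, ih, Finset.prod_range_succ]
    field_simp
    ring

theorem arcsineMoment_add (q k : ℕ) :
    (arcsineMoment (q + k) : ℂ) = arcsineMoment q *
      ((ascPochhammer ℂ k).eval (1 / 2 + q : ℂ) / (ascPochhammer ℂ k).eval (q + 1 : ℂ)) := by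
  induction k with
  | zero => simp
  | succ k ih =>
    rw [ascPochhammer_succ_eval, ascPochhammer_succ_eval, mul_div_mul_comm, ← mul_assoc, ← ih,
      ← add_assoc q k, arcsineMoment_succ]
    push_cast
    ring

/-- The rescaling to `[0, 1]` of the cosine of the phase difference. -/
noncomputable def phaseAlignment (φ : ℝ × ℝ) : ℝ :=
  (1 + Real.cos (φ.1 - φ.2)) / 2

theorem phaseAlignment_mem_Icc (φ : ℝ × ℝ) : phaseAlignment φ ∈ Set.Icc 0 1 := by
  rw [phaseAlignment]
  constructor <;> linarith [Real.neg_one_le_cos (φ.1 - φ.2), Real.cos_le_one (φ.1 - φ.2)]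

@[fun_prop]
theorem measurable_phaseAlignment : Measurable phaseAlignment := by
  unfold phaseAlignment
  fun_prop

theorem phaseAlignment_eq_sin_sq (φ : ℝ × ℝ) :
    phaseAlignment φ = Real.sin ((φ.1 + Real.pi - φ.2) / 2) ^ 2 := by
  rw [phaseAlignment, Real.sin_sq_eq_half_sub, mul_div_cancel₀ _ two_ne_zero,
    add_sub_right_comm, Real.cos_add_pi]
  ring

instance : IsProbabilityMeasure uniformPhase :=
  cond_isProbabilityMeasure_of_finite (by simp [Real.pi_pos])
    (by rw [Real.volume_Ico]; exact ENNReal.ofReal_ne_top)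

theorem integral_uniformPhase {E : Type*} [NormedAddCommGroup E] [NormedSpace ℝ E] (f : ℝ → E) :
    ∫ φ, f φ ∂uniformPhase = (2 * Real.pi)⁻¹ • ∫ φ in (0 : ℝ)..2 * Real.pi, f φ := by
  rw [uniformPhase, ProbabilityTheory.cond, integral_smul_measure, Real.volume_Ico, sub_zero,
    ENNReal.toReal_inv, ENNReal.toReal_ofReal Real.two_pi_pos.le,
    intervalIntegral.integral_of_le Real.two_pi_pos.le, integral_Ico_eq_integral_Ioc]

theorem integral_sub_left_uniformPhase {E : Type*} [NormedAddCommGroup E] [NormedSpace ℝ E]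
    {f : ℝ → E} (hf : f.Periodic (2 * Real.pi)) (a : ℝ) :
    ∫ φ, f (a - φ) ∂uniformPhase = ∫ φ, f φ ∂uniformPhase := by
  have hshift := hf.intervalIntegral_add_eq (a - 2 * Real.pi) 0
  rw [sub_add_cancel, zero_add] at hshift
  rw [integral_uniformPhase, integral_uniformPhase, intervalIntegral.integral_comp_sub_left,
    sub_zero, hshift]

theorem integral_sin_half_sq_pow_uniformPhase (k : ℕ) :
    ∫ φ, (Real.sin (φ / 2) ^ 2) ^ k ∂uniformPhase = arcsineMoment k := by
  simp_rw [integral_uniformPhase, ← pow_mul]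
  rw [intervalIntegral.integral_comp_div (fun x => Real.sin x ^ (2 * k)) two_ne_zero, zero_div,
    mul_div_cancel_left₀ _ two_ne_zero, integral_sin_pow_even, ← arcsineMoment_eq_prod,
    smul_eq_mul, smul_eq_mul]
  field_simp

theorem integrable_phaseAlignment_pow (k : ℕ) :
    Integrable (fun φ => phaseAlignment φ ^ k) (uniformPhase.prod uniformPhase) :=
  .of_bound (measurable_phaseAlignment.pow_const k).aestronglyMeasurable 1
    (.of_forall fun φ => by
      obtain ⟨h0, h1⟩ := phaseAlignment_mem_Icc φ
      rw [norm_pow, Real.norm_of_nonneg h0]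
      exact pow_le_one₀ h0 h1)

theorem integral_phaseAlignment_pow (k : ℕ) :
    ∫ φ, phaseAlignment φ ^ k ∂(uniformPhase.prod uniformPhase) = arcsineMoment k := by
  have hper : Function.Periodic (fun x => (Real.sin (x / 2) ^ 2) ^ k) (2 * Real.pi) := fun x => by
    simp only [add_div, mul_div_cancel_left₀ _ (two_ne_zero (α := ℝ)), Real.sin_add_pi, neg_sq]
  rw [integral_prod _ (integrable_phaseAlignment_pow k)]
  simp_rw [phaseAlignment_eq_sin_sq, integral_sub_left_uniformPhase hper,
    integral_sin_half_sq_pow_uniformPhase, integral_const, probReal_univ, one_smul]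

theorem integrable_ofReal_phaseAlignment_pow (k : ℕ) :
    Integrable (fun φ => (phaseAlignment φ : ℂ) ^ k) (uniformPhase.prod uniformPhase) := by
  exact_mod_cast (integrable_phaseAlignment_pow k).ofReal (𝕜 := ℂ)

theorem integral_phaseAlignment_pow_mul_one_sub_mul_cpow (q : ℕ) (a : ℂ) {z : ℂ}
    (hz : 1 - z ∈ Complex.slitPlane) :
    ∫ φ, (phaseAlignment φ : ℂ) ^ q * (1 - z * phaseAlignment φ) ^ (-a)
        ∂(uniformPhase.prod uniformPhase)
      = arcsineMoment q * gaussHypergeometric a (1 / 2 + q) (q + 1) z := by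
  have hq : (arcsineMoment q : ℂ) ≠ 0 := Complex.ofReal_ne_zero.2 (arcsineMoment_pos q).ne'
  have hmom (k : ℕ) : ∫ φ, (arcsineMoment q : ℂ)⁻¹ * (phaseAlignment φ : ℂ) ^ q
      * (phaseAlignment φ : ℂ) ^ k ∂(uniformPhase.prod uniformPhase)
        = (ascPochhammer ℂ k).eval (1 / 2 + q : ℂ) / (ascPochhammer ℂ k).eval (q + 1 : ℂ) := by
    simp_rw [mul_assoc, ← pow_add, integral_const_mul, ← Complex.ofReal_pow]
    rw [integral_complex_ofReal, integral_phaseAlignment_pow, arcsineMoment_add,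
      inv_mul_cancel_left₀ hq]
  rw [gaussHypergeometric_eq (isGaussHypergeometric_integral measurable_phaseAlignment
    phaseAlignment_mem_Icc ((integrable_ofReal_phaseAlignment_pow q).const_mul _) hmom a) hz]
  simp_rw [mul_assoc, integral_const_mul]
  rw [mul_inv_cancel_left₀ hq]

/-- The mean of `(1 - Δ + 2 Δ T) ^ l (1 - z T) ^ (-a)` for an arcsine distributed `T`, in terms of
Gauss hypergeometric functions. -/
noncomputable def hypergeometricMixture (a : ℂ) (Δ : ℝ) (l : ℕ) (z : ℂ) : ℂ :=
  ∑ q ∈ Finset.range (l + 1), (l.choose q : ℂ) * (1 - Δ : ℂ) ^ (l - q) * (2 * Δ : ℂ) ^ q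
    * (arcsineMoment q : ℂ) * gaussHypergeometric a (1 / 2 + q) (q + 1) z

theorem affine_pow_mul_eq_sum {R : Type*} [CommRing R] (Δ t y : R) (l : ℕ) :
    (1 - Δ + 2 * Δ * t) ^ l * y = ∑ q ∈ Finset.range (l + 1),
      l.choose q * (1 - Δ) ^ (l - q) * (2 * Δ) ^ q * (t ^ q * y) := by
  rw [add_comm, add_pow, Finset.sum_mul]
  exact Finset.sum_congr rfl fun q _ => by ring

theorem integrable_affine_phaseAlignment_pow_mul_cpow (a : ℂ) (Δ : ℝ) (l : ℕ) {z : ℂ}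
    (hz : 1 - z ∈ Complex.slitPlane) :
    Integrable (fun φ => (1 - Δ + 2 * Δ * phaseAlignment φ : ℂ) ^ l
      * (1 - z * phaseAlignment φ) ^ a) (uniformPhase.prod uniformPhase) := by
  simp_rw [affine_pow_mul_eq_sum]
  exact integrable_finsetSum _ fun q _ => (integrable_mul_one_sub_mul_cpow
    measurable_phaseAlignment phaseAlignment_mem_Icc
    (integrable_ofReal_phaseAlignment_pow q) a hz).const_mul _

theorem integral_affine_phaseAlignment_pow_mul_cpow (a : ℂ) (Δ : ℝ) (l : ℕ) {z : ℂ}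
    (hz : 1 - z ∈ Complex.slitPlane) :
    ∫ φ, (1 - Δ + 2 * Δ * phaseAlignment φ : ℂ) ^ l * (1 - z * phaseAlignment φ) ^ (-a)
        ∂(uniformPhase.prod uniformPhase) = hypergeometricMixture a Δ l z := by
  simp_rw [affine_pow_mul_eq_sum]
  rw [integral_finsetSum _ fun q _ => (integrable_mul_one_sub_mul_cpow measurable_phaseAlignment
    phaseAlignment_mem_Icc (integrable_ofReal_phaseAlignment_pow q) (-a) hz).const_mul _]
  simp_rw [integral_const_mul, integral_phaseAlignment_pow_mul_one_sub_mul_cpow _ _ hz,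
    ← mul_assoc, hypergeometricMixture]

end PhaseDifference

section ShadowedRician

theorem gaussianPDFReal_mul_exp_mul_add_sq {v : NNReal} (hv : v ≠ 0) {r : ℝ} (hr : 2 * v * r < 1)
    (a x : ℝ) :
    gaussianPDFReal 0 v x * Real.exp (r * (a + x) ^ 2)
      = (Real.sqrt (1 - 2 * v * r))⁻¹ * Real.exp (a ^ 2 * r / (1 - 2 * v * r))
        * gaussianPDFReal (2 * v * r * a / (1 - 2 * v * r)) (v / (1 - 2 * v * r).toNNReal) x := by
  have hd : 0 < 1 - 2 * v * r := sub_pos.2 hr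
  have hexp : -(x - 0) ^ 2 / (2 * v) + r * (a + x) ^ 2 = a ^ 2 * r / (1 - 2 * v * r)
      + -(x - 2 * v * r * a / (1 - 2 * v * r)) ^ 2 / (2 * (v / (1 - 2 * v * r))) := by
    have hvR : (v : ℝ) ≠ 0 := NNReal.coe_ne_zero.2 hv
    generalize hdd : 1 - 2 * v * r = d at hd
    have hr : r = (1 - d) / (2 * v) := by rw [← hdd]; field_simp; ring
    rw [hr]
    field_simp
    ring
  have hsqrt : Real.sqrt (2 * Real.pi * (v / (1 - 2 * v * r)))
      = Real.sqrt (2 * Real.pi * v) / Real.sqrt (1 - 2 * v * r) := by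
    rw [← mul_div_assoc, Real.sqrt_div' _ hd.le]
  rw [gaussianPDFReal, gaussianPDFReal, NNReal.coe_div, Real.coe_toNNReal _ hd.le, mul_assoc,
    ← Real.exp_add, hexp, Real.exp_add, hsqrt]
  field_simp

theorem lintegral_exp_mul_add_sq_gaussianReal {v : NNReal} (hv : v ≠ 0) {r : ℝ}
    (hr : 2 * v * r < 1) (a : ℝ) :
    ∫⁻ x, ENNReal.ofReal (Real.exp (r * (a + x) ^ 2)) ∂(gaussianReal 0 v)
      = ENNReal.ofReal ((Real.sqrt (1 - 2 * v * r))⁻¹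
        * Real.exp (a ^ 2 * r / (1 - 2 * v * r))) := by
  rw [gaussianReal_of_var_ne_zero _ hv, lintegral_withDensity_eq_lintegral_mul _
    (measurable_gaussianPDF 0 v) (by fun_prop)]
  simp_rw [Pi.mul_apply, gaussianPDF, ← ENNReal.ofReal_mul (gaussianPDFReal_nonneg 0 v _),
    gaussianPDFReal_mul_exp_mul_add_sq hv hr]
  have hv' : v / (1 - 2 * v * r).toNNReal ≠ 0 :=
    div_ne_zero hv (Real.toNNReal_pos.2 (sub_pos.2 hr)).ne'
  simp_rw [ENNReal.ofReal_mul (by positivity : 0 ≤ (Real.sqrt (1 - 2 * v * r))⁻¹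
    * Real.exp (a ^ 2 * r / (1 - 2 * v * r)))]
  rw [lintegral_const_mul' _ _ ENNReal.ofReal_ne_top, lintegral_gaussianPDFReal_eq_one _ hv',
    mul_one]

theorem lintegral_exp_mul_add_sq_add_sq_gaussianReal {v : NNReal} (hv : v ≠ 0) {r : ℝ}
    (hr : 2 * v * r < 1) (a b : ℝ) :
    ∫⁻ p, ENNReal.ofReal (Real.exp (r * ((a + p.1) ^ 2 + (b + p.2) ^ 2)))
        ∂((gaussianReal 0 v).prod (gaussianReal 0 v))
      = ENNReal.ofReal ((1 - 2 * v * r)⁻¹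
        * Real.exp ((a ^ 2 + b ^ 2) * r / (1 - 2 * v * r))) := by
  simp_rw [mul_add r, Real.exp_add, ENNReal.ofReal_mul (Real.exp_nonneg _)]
  rw [lintegral_prod_mul (f := fun x => ENNReal.ofReal (Real.exp (r * (a + x) ^ 2)))
      (g := fun x => ENNReal.ofReal (Real.exp (r * (b + x) ^ 2))) (by fun_prop) (by fun_prop),
    lintegral_exp_mul_add_sq_gaussianReal hv hr, lintegral_exp_mul_add_sq_gaussianReal hv hr,
    ← ENNReal.ofReal_mul (by positivity), mul_mul_mul_comm, ← Real.exp_add, ← mul_inv,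
    Real.mul_self_sqrt (sub_pos.2 hr).le, add_mul, add_div]

theorem gammaPDFReal_mul_exp_mul {a b κ : ℝ} (hb : 0 < b) (hκ : κ < b) (u : ℝ) :
    gammaPDFReal a b u * Real.exp (κ * u) = (b / (b - κ)) ^ a * gammaPDFReal a (b - κ) u := by
  have hd : 0 < b - κ := sub_pos.2 hκ
  unfold gammaPDFReal
  split_ifs
  · rw [mul_assoc, ← Real.exp_add, show -(b * u) + κ * u = -((b - κ) * u) by ring,
      Real.div_rpow hb.le hd.le]
    have := (Real.rpow_pos_of_pos hd a).ne'
    field_simp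
  · simp

theorem lintegral_exp_mul_gammaMeasure {a b κ : ℝ} (ha : 0 < a) (hb : 0 < b) (hκ : κ < b) :
    ∫⁻ u, ENNReal.ofReal (Real.exp (κ * u)) ∂(gammaMeasure a b)
      = ENNReal.ofReal ((b / (b - κ)) ^ a) := by
  have hd : 0 < b - κ := sub_pos.2 hκ
  have hmeas : Measurable (gammaPDF a b) := (measurable_gammaPDFReal a b).ennreal_ofReal
  rw [gammaMeasure, lintegral_withDensity_eq_lintegral_mul _ hmeas (by fun_prop)]
  simp_rw [Pi.mul_apply, gammaPDF, ← ENNReal.ofReal_mul (gammaPDFReal_nonneg ha hb _),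
    gammaPDFReal_mul_exp_mul hb hκ, ENNReal.ofReal_mul (by positivity : 0 ≤ (b / (b - κ)) ^ a)]
  rw [lintegral_const_mul' _ _ ENNReal.ofReal_ne_top]
  exact (congrArg _ (lintegral_gammaPDF_eq_one ha hd)).trans (mul_one _)

theorem ae_nonneg_gammaMeasure (a b : ℝ) : ∀ᵐ u ∂(gammaMeasure a b), 0 ≤ u := by
  rw [gammaMeasure, ae_withDensity_iff (f := gammaPDF a b)
    (measurable_gammaPDFReal a b).ennreal_ofReal]
  exact .of_forall fun u => not_imp_comm.1 fun hu => gammaPDF_of_neg (not_le.1 hu)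

/-- The joint law of the shadowing `ζ` and of the in-phase and quadrature diffuse components. -/
noncomputable def shadowingLaw (m : ℝ) (v : NNReal) : Measure (ℝ × ℝ × ℝ) :=
  (gammaMeasure m m).prod ((gaussianReal 0 v).prod (gaussianReal 0 v))

theorem isProbabilityMeasure_shadowingLaw {m : ℝ} (hm : 0 < m) (v : NNReal) :
    IsProbabilityMeasure (shadowingLaw m v) :=
  have := isProbabilityMeasure_gammaMeasure hm hm
  inferInstanceAs (IsProbabilityMeasure ((gammaMeasure m m).prod _))

/-- The power `|√ζ a + X + jY|²` received when the total specular amplitude is `a ∈ ℂ`, as a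
function of `(ζ, X, Y)`. -/
noncomputable def shadowedPower (a : ℂ) (p : ℝ × ℝ × ℝ) : ℝ :=
  ‖(Real.sqrt p.1 : ℂ) * a + (p.2.1 + Complex.I * p.2.2)‖ ^ 2

theorem shadowedPower_eq (a : ℂ) (p : ℝ × ℝ × ℝ) :
    shadowedPower a p
      = (Real.sqrt p.1 * a.re + p.2.1) ^ 2 + (Real.sqrt p.1 * a.im + p.2.2) ^ 2 := by
  rw [shadowedPower, Complex.sq_norm, Complex.normSq_apply]
  simp [sq]

theorem continuous_uncurry_shadowedPower : Continuous (Function.uncurry shadowedPower) := by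
  unfold Function.uncurry shadowedPower
  fun_prop

theorem measurable_shadowedPower (a : ℂ) : Measurable (shadowedPower a) :=
  (continuous_uncurry_shadowedPower.comp (Continuous.prodMk_right a)).measurable

variable {m r k : ℝ} {v : NNReal} {a : ℂ}

theorem lintegral_exp_mul_shadowedPower (hm : 0 < m) (hv : v ≠ 0) (hr : 2 * v * r < 1)
    (ha : ‖a‖ ^ 2 * r / (1 - 2 * v * r) < m) :
    ∫⁻ p, ENNReal.ofReal (Real.exp (r * shadowedPower a p)) ∂(shadowingLaw m v)
      = ENNReal.ofReal ((1 - 2 * v * r)⁻¹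
        * (m / (m - ‖a‖ ^ 2 * r / (1 - 2 * v * r))) ^ m) := by
  have hslice : ∀ᵐ u ∂(gammaMeasure m m),
      ∫⁻ q, ENNReal.ofReal (Real.exp (r * shadowedPower a (u, q)))
        ∂((gaussianReal 0 v).prod (gaussianReal 0 v))
      = ENNReal.ofReal (1 - 2 * v * r)⁻¹
        * ENNReal.ofReal (Real.exp (‖a‖ ^ 2 * r / (1 - 2 * v * r) * u)) := by
    filter_upwards [ae_nonneg_gammaMeasure m m] with u hu
    simp_rw [shadowedPower_eq]
    rw [lintegral_exp_mul_add_sq_add_sq_gaussianReal hv hr,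
      ENNReal.ofReal_mul (inv_nonneg.2 (sub_pos.2 hr).le), mul_pow, mul_pow, Real.sq_sqrt hu,
      Complex.sq_norm, Complex.normSq_apply]
    ring_nf
  have hmeas := measurable_shadowedPower a
  rw [shadowingLaw, lintegral_prod _ (by fun_prop), lintegral_congr_ae hslice,
    lintegral_const_mul' _ _ ENNReal.ofReal_ne_top, lintegral_exp_mul_gammaMeasure hm hm ha,
    ENNReal.ofReal_mul (inv_nonneg.2 (sub_pos.2 hr).le)]

theorem two_mul_mul_lt_one_of_lt (hm : 0 < m) (hk : 0 ≤ k)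
    (hr : (m + k) * (2 * v * r) < m) : 2 * v * r < 1 := by
  by_contra! h
  nlinarith

theorem lintegral_exp_mul_shadowedPower_of_norm_sq (hm : 0 < m) (hv : v ≠ 0) (hk : 0 ≤ k)
    (ha : ‖a‖ ^ 2 = 2 * v * k) (hr : (m + k) * (2 * v * r) < m) :
    ∫⁻ p, ENNReal.ofReal (Real.exp (r * shadowedPower a p)) ∂(shadowingLaw m v)
      = ENNReal.ofReal (m ^ m * (1 - 2 * v * r) ^ (m - 1)
        * (m - (m + k) * (2 * v * r)) ^ (-m)) := by
  have hr1 := two_mul_mul_lt_one_of_lt hm hk hr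
  have hd : 0 < 1 - 2 * v * r := sub_pos.2 hr1
  have he : 0 < m - (m + k) * (2 * v * r) := sub_pos.2 hr
  have hquot : m - ‖a‖ ^ 2 * r / (1 - 2 * v * r)
      = (m - (m + k) * (2 * v * r)) / (1 - 2 * v * r) := by
    rw [ha]
    field_simp
    ring
  rw [lintegral_exp_mul_shadowedPower hm hv hr1 (sub_pos.1 (hquot ▸ div_pos he hd)), hquot,
    div_div_eq_mul_div, Real.div_rpow (by positivity) he.le, Real.mul_rpow hm.le hd.le,
    Real.rpow_neg he.le, Real.rpow_sub_one hd.ne']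
  congr 1
  ring

theorem integrable_exp_mul_shadowedPower (hm : 0 < m) (hv : v ≠ 0) (hk : 0 ≤ k)
    (ha : ‖a‖ ^ 2 = 2 * v * k) (hr : (m + k) * (2 * v * r) < m) :
    Integrable (fun p => Real.exp (r * shadowedPower a p)) (shadowingLaw m v) := by
  have hmeas := measurable_shadowedPower a
  refine ⟨by fun_prop, (hasFiniteIntegral_iff_ofReal (.of_forall fun _ => Real.exp_nonneg _)).2 ?_⟩
  rw [lintegral_exp_mul_shadowedPower_of_norm_sq hm hv hk ha hr]
  exact ENNReal.ofReal_lt_top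

theorem mgf_shadowedPower (hm : 0 < m) (hv : v ≠ 0) (hk : 0 ≤ k)
    (ha : ‖a‖ ^ 2 = 2 * v * k) (hr : (m + k) * (2 * v * r) < m) :
    mgf (shadowedPower a) (shadowingLaw m v) r
      = m ^ m * (1 - 2 * v * r) ^ (m - 1) * (m - (m + k) * (2 * v * r)) ^ (-m) := by
  have hd : 0 < 1 - 2 * v * r := sub_pos.2 (two_mul_mul_lt_one_of_lt hm hk hr)
  have hE : 0 ≤ (m - (m + k) * (2 * v * r)) ^ (-m) := Real.rpow_nonneg (sub_pos.2 hr).le _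
  have hint := integrable_exp_mul_shadowedPower hm hv hk ha hr
  rw [mgf, integral_eq_lintegral_of_nonneg_ae (.of_forall fun _ => Real.exp_nonneg _)
    hint.aestronglyMeasurable, lintegral_exp_mul_shadowedPower_of_norm_sq hm hv hk ha hr,
    ENNReal.toReal_ofReal (mul_nonneg (by positivity) hE)]

end ShadowedRician

section ComplexMGF

theorem eqOn_of_forall_ofReal_eq {U : Set ℂ} {f g : ℂ → ℂ} (hUo : IsOpen U)
    (hUc : IsPreconnected U) (hf : DifferentiableOn ℂ f U) (hg : DifferentiableOn ℂ g U) {x₀ : ℝ}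
    (hx₀ : (x₀ : ℂ) ∈ U) (h : ∀ x : ℝ, (x : ℂ) ∈ U → f x = g x) : Set.EqOn f g U := by
  refine (hf.analyticOnNhd hUo).eqOn_of_preconnected_of_frequently_eq (hg.analyticOnNhd hUo) hUc
    hx₀ ?_
  have hcont : Continuous (fun x : ℝ => (x : ℂ)) := Complex.continuous_ofReal
  have hlim : Filter.Tendsto (fun x : ℝ => (x : ℂ)) (nhdsWithin x₀ {x₀}ᶜ)
      (nhdsWithin (x₀ : ℂ) {(x₀ : ℂ)}ᶜ) :=
    tendsto_nhdsWithin_iff.2 ⟨hcont.continuousAt.mono_left nhdsWithin_le_nhds,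
      eventually_mem_nhdsWithin.mono fun x hx => by simpa using hx⟩
  have hU : ∀ᶠ x : ℝ in nhdsWithin x₀ {x₀}ᶜ, (x : ℂ) ∈ U :=
    nhdsWithin_le_nhds (hcont.continuousAt (hUo.mem_nhds hx₀))
  exact hlim.frequently (hU.mono h).frequently

theorem integral_pow_mul_cexp_eq_of_hasDerivAt {Ω : Type*} [MeasurableSpace Ω] {μ : Measure Ω}
    {X : Ω → ℝ} {U : Set ℂ} {G : ℕ → ℂ → ℂ} (hU : IsOpen U)
    (hX : ∀ s ∈ U, s.re ∈ interior (integrableExpSet X μ)) (h0 : Set.EqOn (complexMGF X μ) (G 0) U)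
    (hG : ∀ n, ∀ s ∈ U, HasDerivAt (G n) (G (n + 1) s) s) (n : ℕ) :
    Set.EqOn (fun s => ∫ ω, (X ω : ℂ) ^ n * Complex.exp (s * X ω) ∂μ) (G n) U := by
  induction n with
  | zero => simpa [complexMGF, Set.EqOn] using h0
  | succ n ih =>
    intro s hs
    exact (hasDerivAt_integral_pow_mul_exp (hX s hs) n).unique
      ((hG n s hs).congr_of_eventuallyEq (ih.eventuallyEq_of_mem (hU.mem_nhds hs)))

end ComplexMGF

section ShadowedRicianGmgf

theorem sum_choose_mul_recurrence {R : Type*} [CommRing R] (F : ℕ → R) (n : ℕ) :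
    ∑ l ∈ Finset.range (n + 1), (n.choose l : R) * ((n + 1 + l) * F l + (l + 1) * F (l + 1))
      = (n + 1) * ∑ l ∈ Finset.range (n + 2), ((n + 1).choose l : R) * F l := by
  have hshift : ∑ l ∈ Finset.range (n + 1), (n.choose l : R) * ((n + 1 + l) * F l)
      = (∑ l ∈ Finset.range (n + 1), (n.choose (l + 1) : R) * ((n + 1 + (l + 1)) * F (l + 1)))
        + (n + 1) * F 0 := by
    rw [← add_zero (∑ l ∈ Finset.range (n + 1), _)]
    have h := Finset.sum_range_succ' (fun l => (n.choose l : R) * ((n + 1 + l) * F l)) (n + 1)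
    rw [Finset.sum_range_succ, Nat.choose_succ_self] at h
    simpa using h
  have hchoose : ∀ l : ℕ, ((l : R) + 1) * (n.choose l + n.choose (l + 1)) = (n + 1) * n.choose l :=
    fun l => by
      have h := congrArg (Nat.cast (R := R)) (Nat.add_one_mul_choose_eq n l)
      rw [Nat.choose_succ_succ] at h
      push_cast at h
      linear_combination -h
  simp_rw [mul_add (n.choose _ : R)]
  rw [Finset.sum_add_distrib, hshift, Finset.sum_range_succ' _ (n + 1), mul_add, Finset.mul_sum,
    add_right_comm, ← Finset.sum_add_distrib, Nat.choose_zero_right, Nat.cast_one, one_mul]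
  congr 1
  refine Finset.sum_congr rfl fun l _ => ?_
  rw [Nat.choose_succ_succ]
  push_cast
  linear_combination F (l + 1) * hchoose l

/-- The `l`-th term of the closed form `shadowedRicianGmgf` of the generalized moment generating
function, without its binomial coefficient. -/
noncomputable def shadowedRicianTerm (m w k : ℝ) (l : ℕ) (s : ℂ) : ℂ :=
  (ascPochhammer ℂ l).eval (m : ℂ) / (l.factorial : ℂ) * (k : ℂ) ^ l
    * (m - (m + k) * (w * s)) ^ (-(m + l : ℂ))

/-- The closed form of the generalized moment generating function `E[γⁿ e^{sγ}]` of a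
Rician-shadowed power `γ` with fading severity `m`, diffuse power `w` and specular-to-diffuse
ratio `k`. -/
noncomputable def shadowedRicianGmgf (m w k : ℝ) (n : ℕ) (s : ℂ) : ℂ :=
  n.factorial * (w : ℂ) ^ n * (m : ℂ) ^ (m : ℂ) * (1 - w * s) ^ (m - n - 1 : ℂ)
    * ∑ l ∈ Finset.range (n + 1), (n.choose l : ℂ) * shadowedRicianTerm m w k l s

/-- The half-plane on which `shadowedRicianGmgf` is the generalized moment generating function. -/
def shadowedRicianDomain (m w k : ℝ) : Set ℂ :=
  {s | (m + k) * (w * s.re) < m}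

variable {m w k : ℝ} {s : ℂ}

theorem isOpen_shadowedRicianDomain (m w k : ℝ) : IsOpen (shadowedRicianDomain m w k) :=
  isOpen_lt (by fun_prop) continuous_const

theorem isPreconnected_shadowedRicianDomain (m w k : ℝ) :
    IsPreconnected (shadowedRicianDomain m w k) :=
  (convex_halfSpace_lt (f := fun s : ℂ => (m + k) * (w * s.re))
    ⟨fun x y => by simp only [Complex.add_re]; ring,
      fun c x => by simp only [Complex.smul_re, smul_eq_mul]; ring⟩ m).isPreconnected

theorem re_sub_mul_pos_of_mem_domain (hs : s ∈ shadowedRicianDomain m w k) :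
    0 < (m - (m + k) * (w * s) : ℂ).re := by
  simpa using show (m + k) * (w * s.re) < m from hs

theorem re_one_sub_mul_pos_of_mem_domain (hm : 0 < m) (hk : 0 ≤ k)
    (hs : s ∈ shadowedRicianDomain m w k) : 0 < (1 - w * s : ℂ).re := by
  have hs' : (m + k) * (w * s.re) < m := hs
  suffices w * s.re < 1 by simpa using this
  by_contra! h
  nlinarith

theorem hasDerivAt_shadowedRicianTerm (hm : 0 < m) (hk : 0 ≤ k)
    (hs : s ∈ shadowedRicianDomain m w k) (l : ℕ) :
    HasDerivAt (shadowedRicianTerm m w k l)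
      (w / (1 - w * s) * ((m + l) * shadowedRicianTerm m w k l s
        + (l + 1) * shadowedRicianTerm m w k (l + 1) s)) s := by
  have hd : (1 - w * s : ℂ) ≠ 0 :=
    Complex.ne_zero_of_re_pos (re_one_sub_mul_pos_of_mem_domain hm hk hs)
  have hE := re_sub_mul_pos_of_mem_domain hs
  have hE0 : (m - (m + k) * (w * s) : ℂ) ≠ 0 := Complex.ne_zero_of_re_pos hE
  have hlin : HasDerivAt (fun s : ℂ => (m - (m + k) * (w * s) : ℂ)) (-((m + k) * w)) s := by
    simpa using (((hasDerivAt_id s).const_mul (w : ℂ)).const_mul (m + k : ℂ)).const_sub (m : ℂ)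
  refine ((hlin.cpow_const (c := -(m + l : ℂ)) (.inl hE)).const_mul
    ((ascPochhammer ℂ l).eval (m : ℂ) / (l.factorial : ℂ) * (k : ℂ) ^ l)).congr_deriv ?_
  have hl : (l + 1 : ℂ) ≠ 0 := Nat.cast_add_one_ne_zero l
  have hf : (l.factorial : ℂ) ≠ 0 := Nat.cast_ne_zero.2 l.factorial_ne_zero
  rw [shadowedRicianTerm, shadowedRicianTerm, ascPochhammer_succ_eval, Nat.factorial_succ,
    show (-(m + (l + 1 : ℕ)) : ℂ) = -(m + l) - 1 by push_cast; ring, Complex.cpow_sub _ _ hE0,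
    Complex.cpow_one]
  have hmk : (m + k : ℂ) = (m - (m + k) * (w * s) + k) / (1 - w * s) := by
    field_simp
    ring
  generalize (m - (m + k) * (w * s) : ℂ) = E at hE0 hmk ⊢
  push_cast
  rw [hmk]
  field_simp
  ring

theorem hasDerivAt_shadowedRicianGmgf (hm : 0 < m) (hk : 0 ≤ k)
    (hs : s ∈ shadowedRicianDomain m w k) (n : ℕ) :
    HasDerivAt (shadowedRicianGmgf m w k n) (shadowedRicianGmgf m w k (n + 1) s) s := by
  have hd := re_one_sub_mul_pos_of_mem_domain hm hk hs
  have hd0 : (1 - w * s : ℂ) ≠ 0 := Complex.ne_zero_of_re_pos hd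
  have hlin : HasDerivAt (fun s : ℂ => (1 - w * s : ℂ)) (-w) s := by
    simpa using ((hasDerivAt_id s).const_mul (w : ℂ)).const_sub (1 : ℂ)
  have hsum := HasDerivAt.fun_sum fun l (_ : l ∈ Finset.range (n + 1)) =>
    (hasDerivAt_shadowedRicianTerm hm hk hs l).const_mul (n.choose l : ℂ)
  refine (((hlin.cpow_const (c := (m - n - 1 : ℂ)) (.inl hd)).const_mul
    (n.factorial * (w : ℂ) ^ n * (m : ℂ) ^ (m : ℂ))).mul hsum).congr_deriv ?_
  have hrec := sum_choose_mul_recurrence (fun l => shadowedRicianTerm m w k l s) n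
  have hsplit : ∑ l ∈ Finset.range (n + 1), (n.choose l : ℂ) * (w / (1 - w * s) *
        ((m + l) * shadowedRicianTerm m w k l s + (l + 1) * shadowedRicianTerm m w k (l + 1) s))
      = w / (1 - w * s) * ((n + 1) * ∑ l ∈ Finset.range (n + 2),
          ((n + 1).choose l : ℂ) * shadowedRicianTerm m w k l s
        + (m - n - 1) * ∑ l ∈ Finset.range (n + 1),
          (n.choose l : ℂ) * shadowedRicianTerm m w k l s) := by
    rw [← hrec, Finset.mul_sum (Finset.range (n + 1)) _ (m - n - 1 : ℂ),
      ← Finset.sum_add_distrib, Finset.mul_sum]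
    exact Finset.sum_congr rfl fun l _ => by ring
  rw [hsplit, shadowedRicianGmgf, Nat.factorial_succ,
    show (m - (n + 1 : ℕ) - 1 : ℂ) = m - n - 1 - 1 by push_cast; ring, Complex.cpow_sub _ _ hd0,
    Complex.cpow_one]
  push_cast
  field_simp
  ring

theorem mem_shadowedRicianDomain_of_le {k' : ℝ} (hm : 0 < m) (hk : 0 ≤ k) (hkk' : k ≤ k')
    (hs : s ∈ shadowedRicianDomain m w k') : s ∈ shadowedRicianDomain m w k := by
  have hs' : (m + k') * (w * s.re) < m := hs
  change (m + k) * (w * s.re) < m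
  rcases le_or_gt (w * s.re) 0 with h | h <;> nlinarith

theorem re_mem_interior_integrableExpSet {Ω : Type*} [MeasurableSpace Ω] {μ : Measure Ω}
    {X : Ω → ℝ} (hX : ∀ r : ℝ, (r : ℂ) ∈ shadowedRicianDomain m w k →
      Integrable (fun ω => Real.exp (r * X ω)) μ) (hs : s ∈ shadowedRicianDomain m w k) :
    s.re ∈ interior (integrableExpSet X μ) :=
  interior_maximal (t := {r : ℝ | (r : ℂ) ∈ shadowedRicianDomain m w k}) hX
    ((isOpen_shadowedRicianDomain m w k).preimage Complex.continuous_ofReal) hs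

theorem shadowedRicianGmgf_zero_ofReal {r : ℝ} (hm : 0 < m) (hk : 0 ≤ k)
    (hr : (r : ℂ) ∈ shadowedRicianDomain m w k) :
    shadowedRicianGmgf m w k 0 r
      = (m ^ m * (1 - w * r) ^ (m - 1) * (m - (m + k) * (w * r)) ^ (-m) : ℝ) := by
  have hd : 0 < 1 - w * r := by simpa using re_one_sub_mul_pos_of_mem_domain hm hk hr
  have he : 0 < m - (m + k) * (w * r) := sub_pos.2 hr
  simp only [shadowedRicianGmgf, shadowedRicianTerm, Nat.factorial_zero, Nat.cast_one, pow_zero,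
    one_mul, zero_add, Finset.sum_range_one, Nat.choose_self, ascPochhammer_zero,
    Polynomial.eval_one, div_one, CharP.cast_eq_zero, add_zero, sub_zero]
  rw [Complex.ofReal_mul, Complex.ofReal_mul, Complex.ofReal_cpow hm.le, Complex.ofReal_cpow hd.le,
    Complex.ofReal_cpow he.le]
  push_cast
  rfl

theorem shadowedRicianGmgf_one_zero (hm : 0 < m) :
    shadowedRicianGmgf m w k 1 0 = w * (1 + k) := by
  have hm0 : (m : ℂ) ≠ 0 := Complex.ofReal_ne_zero.2 hm.ne'
  have hmm : (m : ℂ) ^ (m : ℂ) ≠ 0 := by simp [Complex.cpow_eq_zero_iff, hm0]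
  have hsum : shadowedRicianGmgf m w k 1 0 = w * (m : ℂ) ^ (m : ℂ) *
      (((m : ℂ) ^ (m : ℂ))⁻¹ + m * k * ((m : ℂ)⁻¹ * ((m : ℂ) ^ (m : ℂ))⁻¹)) := by
    simp [shadowedRicianGmgf, shadowedRicianTerm, Finset.sum_range_succ, Complex.cpow_neg,
      Complex.cpow_add _ _ hm0, ascPochhammer_one]
  rw [hsum]
  field_simp

theorem integral_pow_mul_cexp_shadowedPower {v : NNReal} {a : ℂ} (hm : 0 < m) (hv : v ≠ 0)
    (hk : 0 ≤ k) (ha : ‖a‖ ^ 2 = 2 * v * k) (hs : s ∈ shadowedRicianDomain m (2 * v) k) (n : ℕ) :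
    ∫ p, (shadowedPower a p : ℂ) ^ n * Complex.exp (s * shadowedPower a p) ∂(shadowingLaw m v)
      = shadowedRicianGmgf m (2 * v) k n s := by
  have hopen := isOpen_shadowedRicianDomain m (2 * v) k
  have hX : ∀ s ∈ shadowedRicianDomain m (2 * v) k,
      s.re ∈ interior (integrableExpSet (shadowedPower a) (shadowingLaw m v)) := fun s =>
    re_mem_interior_integrableExpSet fun r hr => integrable_exp_mul_shadowedPower hm hv hk ha hr
  have hG : ∀ n, ∀ s ∈ shadowedRicianDomain m (2 * v) k, HasDerivAt
      (shadowedRicianGmgf m (2 * v) k n) (shadowedRicianGmgf m (2 * v) k (n + 1) s) s :=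
    fun n s hs => hasDerivAt_shadowedRicianGmgf hm hk hs n
  refine integral_pow_mul_cexp_eq_of_hasDerivAt hopen hX ?_ hG n hs
  refine eqOn_of_forall_ofReal_eq hopen (isPreconnected_shadowedRicianDomain m (2 * v) k)
    (differentiableOn_complexMGF.mono hX)
    (fun s hs => (hG 0 s hs).differentiableAt.differentiableWithinAt) (x₀ := 0)
    (by simpa [shadowedRicianDomain] using hm) fun r hr => ?_
  rw [complexMGF_ofReal, mgf_shadowedPower (r := r) hm hv hk ha hr,
    shadowedRicianGmgf_zero_ofReal hm hk hr]

end ShadowedRicianGmgf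

section TwoRay

/-- The total specular amplitude `V₁ exp(j φ₁) + V₂ exp(j φ₂)`. -/
noncomputable def specularAmplitude (V₁ V₂ : ℝ) (φ : ℝ × ℝ) : ℂ :=
  V₁ * Complex.exp (Complex.I * φ.1) + V₂ * Complex.exp (Complex.I * φ.2)

/-- The specular-to-diffuse power ratio of the two-ray channel conditionally on the phases. -/
noncomputable def specularRatio (K Δ : ℝ) (φ : ℝ × ℝ) : ℝ :=
  K * (1 - Δ + 2 * Δ * phaseAlignment φ)

/-- The joint law of `((φ₁, φ₂), (ζ, X, Y))`. -/
noncomputable def twoRayLaw (m : ℝ) (v : NNReal) : Measure ((ℝ × ℝ) × (ℝ × ℝ × ℝ)) :=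
  (uniformPhase.prod uniformPhase).prod (shadowingLaw m v)

/-- The power received over the two-ray channel, as a function of `((φ₁, φ₂), (ζ, X, Y))`. -/
noncomputable def twoRayPower (V₁ V₂ : ℝ) (p : (ℝ × ℝ) × (ℝ × ℝ × ℝ)) : ℝ :=
  shadowedPower (specularAmplitude V₁ V₂ p.1) p.2

theorem norm_sq_specularAmplitude (V₁ V₂ : ℝ) (φ : ℝ × ℝ) :
    ‖specularAmplitude V₁ V₂ φ‖ ^ 2
      = V₁ ^ 2 + V₂ ^ 2 + 2 * V₁ * V₂ * (2 * phaseAlignment φ - 1) := by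
  rw [specularAmplitude, mul_comm Complex.I, mul_comm Complex.I, Complex.sq_norm,
    Complex.normSq_apply]
  simp only [Complex.add_re, Complex.add_im, Complex.re_ofReal_mul, Complex.im_ofReal_mul,
    Complex.exp_ofReal_mul_I_re, Complex.exp_ofReal_mul_I_im]
  rw [phaseAlignment, Real.cos_sub]
  linear_combination V₁ ^ 2 * Real.sin_sq_add_cos_sq φ.1 + V₂ ^ 2 * Real.sin_sq_add_cos_sq φ.2

theorem norm_sq_specularAmplitude_eq_mul_specularRatio {V₁ V₂ K Δ w : ℝ}
    (hK : w * K = V₁ ^ 2 + V₂ ^ 2) (hΔ : Δ * (V₁ ^ 2 + V₂ ^ 2) = 2 * V₁ * V₂) (φ : ℝ × ℝ) :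
    ‖specularAmplitude V₁ V₂ φ‖ ^ 2 = w * specularRatio K Δ φ := by
  rw [norm_sq_specularAmplitude, ← hΔ, ← hK, specularRatio]
  ring

theorem specularRatio_mem_Icc {K Δ : ℝ} (hK : 0 ≤ K) (hΔ0 : 0 ≤ Δ) (hΔ1 : Δ ≤ 1) (φ : ℝ × ℝ) :
    specularRatio K Δ φ ∈ Set.Icc 0 (K * (1 + Δ)) := by
  obtain ⟨h0, h1⟩ := phaseAlignment_mem_Icc φ
  rw [specularRatio]
  constructor
  · have : 0 ≤ 1 - Δ := sub_nonneg.2 hΔ1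
    positivity
  · exact mul_le_mul_of_nonneg_left (by nlinarith) hK

theorem measurable_specularRatio (K Δ : ℝ) : Measurable (specularRatio K Δ) := by
  unfold specularRatio
  fun_prop

theorem measurable_twoRayPower (V₁ V₂ : ℝ) : Measurable (twoRayPower V₁ V₂) := by
  have hcont : Continuous (specularAmplitude V₁ V₂) := by
    unfold specularAmplitude
    fun_prop
  exact (continuous_uncurry_shadowedPower.comp (hcont.prodMap continuous_id)).measurable

theorem measurePreserving_prod_left_comm {α β γ : Type*} [MeasurableSpace α] [MeasurableSpace β]
    [MeasurableSpace γ] (μ : Measure α) (ν : Measure β) (τ : Measure γ) [SFinite μ] [SFinite ν]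
    [SFinite τ] :
    MeasurePreserving (fun p : α × β × γ => (p.2.1, p.1, p.2.2))
      (μ.prod (ν.prod τ)) (ν.prod (μ.prod τ)) :=
  (measurePreserving_prodAssoc ν μ τ).comp ((Measure.measurePreserving_swap.prod (.id τ)).comp
    ((measurePreserving_prodAssoc μ ν τ).symm _))

theorem envelopePowerLaw_eq_map_twoRayPower {m : ℝ} (hm : 0 < m) (V₁ V₂ σ : ℝ) :
    envelopePowerLaw m V₁ V₂ σ
      = (twoRayLaw m (σ ^ 2).toNNReal).map (twoRayPower V₁ V₂) := by
  have := isProbabilityMeasure_gammaMeasure hm hm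
  set G := (gaussianReal 0 (σ ^ 2).toNNReal).prod (gaussianReal 0 (σ ^ 2).toNNReal)
  have hmp : MeasurePreserving
      (fun p : ℝ × ℝ × ℝ × ℝ × ℝ => ((p.2.1, p.2.2.1), (p.1, p.2.2.2)))
      ((gammaMeasure m m).prod (uniformPhase.prod (uniformPhase.prod G)))
      (twoRayLaw m (σ ^ 2).toNNReal) :=
    (measurePreserving_prod_left_comm (gammaMeasure m m) (uniformPhase.prod uniformPhase) G).comp
      ((MeasurePreserving.id _).prod ((measurePreserving_prodAssoc _ _ _).symm _))
  rw [← hmp.map_eq, Measure.map_map (measurable_twoRayPower V₁ V₂) hmp.measurable,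
    envelopePowerLaw]
  congr 1
  ext p
  simp only [Function.comp_apply, twoRayPower, shadowedPower, specularAmplitude, receivedSignal]
  congr 2
  ring

variable {m V₁ V₂ K Δ : ℝ} {v : NNReal} {s : ℂ}

theorem mem_domain_specularRatio (hm : 0 < m) (hK0 : 0 ≤ K) (hΔ0 : 0 ≤ Δ) (hΔ1 : Δ ≤ 1) {w : ℝ}
    (hs : s ∈ shadowedRicianDomain m w (K * (1 + Δ))) (φ : ℝ × ℝ) :
    s ∈ shadowedRicianDomain m w (specularRatio K Δ φ) :=
  have h := specularRatio_mem_Icc hK0 hΔ0 hΔ1 φ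
  mem_shadowedRicianDomain_of_le hm h.1 h.2 hs

theorem integrable_rpow_specularRatio (hm : 0 < m) (hK0 : 0 ≤ K) (hΔ0 : 0 ≤ Δ) (hΔ1 : Δ ≤ 1)
    {w r : ℝ} (hr : (r : ℂ) ∈ shadowedRicianDomain m w (K * (1 + Δ))) (a : ℝ) :
    Integrable (fun φ => (m - (m + specularRatio K Δ φ) * (w * r)) ^ a)
      (uniformPhase.prod uniformPhase) := by
  have hcont : ContinuousOn (fun k => (m - (m + k) * (w * r)) ^ a) (Set.Icc 0 (K * (1 + Δ))) :=
    ContinuousOn.rpow_const (by fun_prop) fun k hk =>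
      .inl (sub_pos.2 (mem_shadowedRicianDomain_of_le hm hk.1 hk.2 hr)).ne'
  obtain ⟨C, hC⟩ := isCompact_Icc.exists_bound_of_continuousOn hcont
  have hmeas : Measurable fun φ => (m - (m + specularRatio K Δ φ) * (w * r)) ^ a :=
    (((measurable_specularRatio K Δ).const_add m).mul_const (w * r)).const_sub m |>.pow_const a
  exact .of_bound hmeas.aestronglyMeasurable C
    (.of_forall fun φ => hC _ (specularRatio_mem_Icc hK0 hΔ0 hΔ1 φ))

theorem integrable_exp_mul_twoRayPower (hm : 0 < m) (hv : v ≠ 0) (hK0 : 0 ≤ K)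
    (hK : 2 * v * K = V₁ ^ 2 + V₂ ^ 2) (hΔ0 : 0 ≤ Δ) (hΔ1 : Δ ≤ 1)
    (hΔ : Δ * (V₁ ^ 2 + V₂ ^ 2) = 2 * V₁ * V₂) {r : ℝ}
    (hr : (r : ℂ) ∈ shadowedRicianDomain m (2 * v) (K * (1 + Δ))) :
    Integrable (fun p => Real.exp (r * twoRayPower V₁ V₂ p)) (twoRayLaw m v) := by
  have := isProbabilityMeasure_shadowingLaw hm v
  have hratio (φ) := (specularRatio_mem_Icc hK0 hΔ0 hΔ1 φ).1
  have hdom (φ) : (m + specularRatio K Δ φ) * (2 * v * r) < m :=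
    mem_domain_specularRatio hm hK0 hΔ0 hΔ1 hr φ
  have hnorm := norm_sq_specularAmplitude_eq_mul_specularRatio hK hΔ
  have hmeas := measurable_twoRayPower V₁ V₂
  have hmgf (φ : ℝ × ℝ) : ∫ p, ‖Real.exp (r * twoRayPower V₁ V₂ (φ, p))‖ ∂(shadowingLaw m v)
      = m ^ m * (1 - 2 * v * r) ^ (m - 1)
        * (m - (m + specularRatio K Δ φ) * (2 * v * r)) ^ (-m) := by
    simp_rw [Real.norm_of_nonneg (Real.exp_nonneg _)]
    simpa only [mgf, twoRayPower] using mgf_shadowedPower hm hv (hratio φ) (hnorm φ) (hdom φ)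
  have hmeasExp : Measurable fun p => Real.exp (r * twoRayPower V₁ V₂ p) :=
    (hmeas.const_mul r).exp
  rw [twoRayLaw, integrable_prod_iff hmeasExp.aestronglyMeasurable]
  refine ⟨.of_forall fun φ => ?_, ?_⟩
  · simpa only [twoRayPower] using
      integrable_exp_mul_shadowedPower hm hv (hratio φ) (hnorm φ) (hdom φ)
  · simp_rw [hmgf]
    exact (integrable_rpow_specularRatio hm hK0 hΔ0 hΔ1 hr (-m)).const_mul _

theorem integrable_pow_mul_cexp_twoRayPower (hm : 0 < m) (hv : v ≠ 0) (hK0 : 0 ≤ K)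
    (hK : 2 * v * K = V₁ ^ 2 + V₂ ^ 2) (hΔ0 : 0 ≤ Δ) (hΔ1 : Δ ≤ 1)
    (hΔ : Δ * (V₁ ^ 2 + V₂ ^ 2) = 2 * V₁ * V₂)
    (hs : s ∈ shadowedRicianDomain m (2 * v) (K * (1 + Δ))) (n : ℕ) :
    Integrable (fun p => (twoRayPower V₁ V₂ p : ℂ) ^ n * Complex.exp (s * twoRayPower V₁ V₂ p))
      (twoRayLaw m v) :=
  integrable_pow_mul_cexp_of_re_mem_interior_integrableExpSet (re_mem_interior_integrableExpSet
    (fun _ hr => integrable_exp_mul_twoRayPower hm hv hK0 hK hΔ0 hΔ1 hΔ hr) hs) n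

theorem integral_pow_mul_cexp_twoRayPower (hm : 0 < m) (hv : v ≠ 0) (hK0 : 0 ≤ K)
    (hK : 2 * v * K = V₁ ^ 2 + V₂ ^ 2) (hΔ0 : 0 ≤ Δ) (hΔ1 : Δ ≤ 1)
    (hΔ : Δ * (V₁ ^ 2 + V₂ ^ 2) = 2 * V₁ * V₂)
    (hs : s ∈ shadowedRicianDomain m (2 * v) (K * (1 + Δ))) (n : ℕ) :
    ∫ p, (twoRayPower V₁ V₂ p : ℂ) ^ n * Complex.exp (s * twoRayPower V₁ V₂ p) ∂(twoRayLaw m v)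
      = ∫ φ, shadowedRicianGmgf m (2 * v) (specularRatio K Δ φ) n s
          ∂(uniformPhase.prod uniformPhase) := by
  have := isProbabilityMeasure_shadowingLaw hm v
  have hint := integrable_pow_mul_cexp_twoRayPower hm hv hK0 hK hΔ0 hΔ1 hΔ hs n
  rw [twoRayLaw] at hint ⊢
  rw [integral_prod _ hint]
  exact integral_congr_ae (.of_forall fun φ => integral_pow_mul_cexp_shadowedPower hm hv
    (specularRatio_mem_Icc hK0 hΔ0 hΔ1 φ).1
    (norm_sq_specularAmplitude_eq_mul_specularRatio hK hΔ φ)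
    (mem_domain_specularRatio hm hK0 hΔ0 hΔ1 hs φ) n)

theorem integral_specularRatio (K Δ : ℝ) :
    ∫ φ, specularRatio K Δ φ ∂(uniformPhase.prod uniformPhase) = K := by
  have hmean : ∫ φ, phaseAlignment φ ∂(uniformPhase.prod uniformPhase) = 1 / 2 := by
    have h := integral_phaseAlignment_pow 1
    rw [arcsineMoment_succ, arcsineMoment_zero] at h
    simpa using h
  have hint : Integrable phaseAlignment (uniformPhase.prod uniformPhase) := by
    simpa using integrable_phaseAlignment_pow 1
  simp_rw [specularRatio]
  rw [integral_const_mul, integral_add (integrable_const _) (hint.const_mul _), integral_const_mul,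
    hmean, integral_const, probReal_univ, one_smul]
  ring

theorem integral_twoRayPower (hm : 0 < m) (hv : v ≠ 0) (hK0 : 0 ≤ K)
    (hK : 2 * v * K = V₁ ^ 2 + V₂ ^ 2) (hΔ0 : 0 ≤ Δ) (hΔ1 : Δ ≤ 1)
    (hΔ : Δ * (V₁ ^ 2 + V₂ ^ 2) = 2 * V₁ * V₂) :
    ∫ p, twoRayPower V₁ V₂ p ∂(twoRayLaw m v) = 2 * v * (1 + K) := by
  have h := integral_pow_mul_cexp_twoRayPower hm hv hK0 hK hΔ0 hΔ1 hΔ (s := 0)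
    (by simpa [shadowedRicianDomain] using hm) 1
  have hint : Integrable (specularRatio K Δ) (uniformPhase.prod uniformPhase) :=
    .of_bound (measurable_specularRatio K Δ).aestronglyMeasurable (K * (1 + Δ)) (.of_forall fun φ =>
      have hφ := specularRatio_mem_Icc hK0 hΔ0 hΔ1 φ
      (Real.norm_of_nonneg hφ.1).trans_le hφ.2)
  simp_rw [shadowedRicianGmgf_one_zero hm, zero_mul, Complex.exp_zero, mul_one, pow_one] at h
  have hreal : ∫ p, twoRayPower V₁ V₂ p ∂(twoRayLaw m v)
      = ∫ φ, 2 * v * (1 + specularRatio K Δ φ) ∂(uniformPhase.prod uniformPhase) := by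
    exact_mod_cast h
  rw [hreal, integral_const_mul, integral_add (integrable_const _) hint, integral_specularRatio,
    integral_const, probReal_univ, one_smul]

theorem exists_identDistrib_twoRayPower_of_isFTR {Ω : Type*} [MeasurableSpace Ω] {P : Measure Ω}
    {γ : Ω → ℝ} {γbar : ℝ} (hγ : IsFTR γ γbar m K Δ P) :
    ∃ (V₁ V₂ : ℝ) (v : NNReal), v ≠ 0 ∧ 0 ≤ K ∧ 2 * v * K = V₁ ^ 2 + V₂ ^ 2 ∧
      Δ * (V₁ ^ 2 + V₂ ^ 2) = 2 * V₁ * V₂ ∧ γbar = 2 * v * (1 + K) ∧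
      IdentDistrib γ (twoRayPower V₁ V₂) P (twoRayLaw m v) := by
  obtain ⟨hm, hΔ0, hΔ1, V₁, V₂, σ, -, -, hσ, hKdef, hΔ, hmean, hlaw⟩ := hγ
  have hvσ : ((σ ^ 2).toNNReal : ℝ) = σ ^ 2 := Real.coe_toNNReal _ (sq_nonneg σ)
  have hv : (σ ^ 2).toNNReal ≠ 0 := (Real.toNNReal_pos.2 (by positivity)).ne'
  have hK0 : 0 ≤ K := by
    rw [hKdef]
    positivity
  have hK : 2 * (σ ^ 2).toNNReal * K = V₁ ^ 2 + V₂ ^ 2 := by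
    rw [hvσ, hKdef]
    field_simp
  have hid : IdentDistrib γ (twoRayPower V₁ V₂) P (twoRayLaw m (σ ^ 2).toNNReal) :=
    ⟨hlaw.aemeasurable, (measurable_twoRayPower V₁ V₂).aemeasurable,
      hlaw.map_eq.trans (envelopePowerLaw_eq_map_twoRayPower hm V₁ V₂ σ)⟩
  refine ⟨V₁, V₂, _, hv, hK0, hK, hΔ, ?_, hid⟩
  rw [hmean, ← hlaw.integral_eq, hid.integral_eq,
    integral_twoRayPower hm hv hK0 hK hΔ0 hΔ1 hΔ]

end TwoRay

section PhaseAverage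

theorem mul_cpow_of_re_pos {x y : ℂ} (hx : 0 < x.re) (hy : 0 < y.re) (a : ℂ) :
    (x * y) ^ a = x ^ a * y ^ a := by
  have hx0 : x ≠ 0 := Complex.ne_zero_of_re_pos hx
  have hy0 : y ≠ 0 := Complex.ne_zero_of_re_pos hy
  have hargx := abs_lt.1 (Complex.abs_arg_lt_pi_div_two_iff.2 (.inl hx))
  have hargy := abs_lt.1 (Complex.abs_arg_lt_pi_div_two_iff.2 (.inl hy))
  rw [Complex.cpow_def_of_ne_zero (mul_ne_zero hx0 hy0), Complex.cpow_def_of_ne_zero hx0,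
    Complex.cpow_def_of_ne_zero hy0, Complex.log_mul hx0 hy0 ⟨by linarith, by linarith⟩, add_mul,
    Complex.exp_add]

theorem re_inv_pos_of_re_pos {y : ℂ} (hy : 0 < y.re) : 0 < (y⁻¹).re := by
  rw [Complex.inv_re]
  exact div_pos hy (Complex.normSq_pos.2 (Complex.ne_zero_of_re_pos hy))

theorem cpow_mul_div_cpow_of_re_pos {x y : ℂ} (hx : 0 < x.re) (hy : 0 < y.re) (a : ℂ) :
    y ^ a * (x / y) ^ a = x ^ a := by
  have hy0 : y ≠ 0 := Complex.ne_zero_of_re_pos hy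
  rw [div_eq_mul_inv, mul_cpow_of_re_pos hx (re_inv_pos_of_re_pos hy),
    Complex.inv_cpow _ _ (Complex.slitPlane_arg_ne_pi (.inl hy)), mul_left_comm,
    mul_inv_cancel₀ (by simp [Complex.cpow_eq_zero_iff, hy0]), mul_one]

theorem div_mem_slitPlane_of_re_pos {x y : ℂ} (hx : 0 < x.re) (hy : 0 < y.re) :
    x / y ∈ Complex.slitPlane := by
  have hx0 : x ≠ 0 := Complex.ne_zero_of_re_pos hx
  have hy0 : y ≠ 0 := Complex.ne_zero_of_re_pos hy
  have hargx := abs_lt.1 (Complex.abs_arg_lt_pi_div_two_iff.2 (.inl hx))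
  have hargy := abs_lt.1 (Complex.abs_arg_lt_pi_div_two_iff.2 (.inl (re_inv_pos_of_re_pos hy)))
  rw [Complex.mem_slitPlane_iff_arg, div_eq_mul_inv, Complex.arg_mul hx0 (inv_ne_zero hy0)
    ⟨by linarith, by linarith⟩]
  exact ⟨by linarith, mul_ne_zero hx0 (inv_ne_zero hy0)⟩

/-- The value of `m - (m + k) w s` at the smallest specular-to-diffuse ratio `k = K (1 - Δ)`. -/
noncomputable def twoRayDenominator (m w K Δ : ℝ) (s : ℂ) : ℂ :=
  m - (m + K - K * Δ) * (w * s)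

/-- The argument of the hypergeometric functions in the generalized moment generating function of
the two-ray power. -/
noncomputable def twoRayArgument (m w K Δ : ℝ) (s : ℂ) : ℂ :=
  2 * K * Δ * (w * s) / twoRayDenominator m w K Δ s

variable {m w K Δ : ℝ} {s : ℂ}

theorem re_twoRayDenominator_pos (hm : 0 < m) (hK0 : 0 ≤ K) (hΔ0 : 0 ≤ Δ) (hΔ1 : Δ ≤ 1)
    (hs : s ∈ shadowedRicianDomain m w (K * (1 + Δ))) : 0 < (twoRayDenominator m w K Δ s).re := by
  have hmem : s ∈ shadowedRicianDomain m w (K * (1 - Δ)) :=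
    mem_shadowedRicianDomain_of_le hm (mul_nonneg hK0 (sub_nonneg.2 hΔ1))
      (mul_le_mul_of_nonneg_left (by linarith) hK0) hs
  convert re_sub_mul_pos_of_mem_domain hmem using 2
  rw [twoRayDenominator]
  push_cast
  ring

theorem sub_mul_specularRatio_div_twoRayDenominator (hD : twoRayDenominator m w K Δ s ≠ 0)
    (φ : ℝ × ℝ) :
    (m - (m + specularRatio K Δ φ) * (w * s)) / twoRayDenominator m w K Δ s
      = 1 - twoRayArgument m w K Δ s * phaseAlignment φ := by
  rw [twoRayArgument, div_mul_eq_mul_div, one_sub_div hD, twoRayDenominator, specularRatio]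
  push_cast
  ring

theorem one_sub_twoRayArgument_mem_slitPlane (hm : 0 < m) (hK0 : 0 ≤ K) (hΔ0 : 0 ≤ Δ)
    (hΔ1 : Δ ≤ 1) (hs : s ∈ shadowedRicianDomain m w (K * (1 + Δ))) :
    1 - twoRayArgument m w K Δ s ∈ Complex.slitPlane := by
  have hD := re_twoRayDenominator_pos hm hK0 hΔ0 hΔ1 hs
  have hD0 : twoRayDenominator m w K Δ s ≠ 0 := Complex.ne_zero_of_re_pos hD
  convert div_mem_slitPlane_of_re_pos (re_sub_mul_pos_of_mem_domain hs) hD using 1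
  rw [twoRayArgument, one_sub_div hD0, twoRayDenominator]
  push_cast
  ring

theorem shadowedRicianTerm_specularRatio (hm : 0 < m) (hK0 : 0 ≤ K) (hΔ0 : 0 ≤ Δ) (hΔ1 : Δ ≤ 1)
    (hs : s ∈ shadowedRicianDomain m w (K * (1 + Δ))) (l : ℕ) (φ : ℝ × ℝ) :
    shadowedRicianTerm m w (specularRatio K Δ φ) l s
      = (ascPochhammer ℂ l).eval (m : ℂ) / (l.factorial : ℂ)
        * (K ^ l / twoRayDenominator m w K Δ s ^ (m + l : ℂ))
        * ((1 - Δ + 2 * Δ * phaseAlignment φ) ^ l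
          * (1 - twoRayArgument m w K Δ s * phaseAlignment φ) ^ (-(m + l : ℂ))) := by
  have hD := re_twoRayDenominator_pos hm hK0 hΔ0 hΔ1 hs
  have hD0 : twoRayDenominator m w K Δ s ≠ 0 := Complex.ne_zero_of_re_pos hD
  have hE := re_sub_mul_pos_of_mem_domain (mem_domain_specularRatio hm hK0 hΔ0 hΔ1 hs φ)
  rw [shadowedRicianTerm, ← cpow_mul_div_cpow_of_re_pos hE hD,
    sub_mul_specularRatio_div_twoRayDenominator hD0, specularRatio,
    Complex.cpow_neg (twoRayDenominator _ _ _ _ _)]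
  push_cast
  rw [mul_pow]
  ring

theorem integrable_shadowedRicianTerm_specularRatio (hm : 0 < m) (hK0 : 0 ≤ K) (hΔ0 : 0 ≤ Δ)
    (hΔ1 : Δ ≤ 1) (hs : s ∈ shadowedRicianDomain m w (K * (1 + Δ))) (l : ℕ) :
    Integrable (fun φ => shadowedRicianTerm m w (specularRatio K Δ φ) l s)
      (uniformPhase.prod uniformPhase) := by
  simp_rw [shadowedRicianTerm_specularRatio hm hK0 hΔ0 hΔ1 hs l]
  exact (integrable_affine_phaseAlignment_pow_mul_cpow _ Δ l
    (one_sub_twoRayArgument_mem_slitPlane hm hK0 hΔ0 hΔ1 hs)).const_mul _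

theorem integral_shadowedRicianTerm_specularRatio (hm : 0 < m) (hK0 : 0 ≤ K) (hΔ0 : 0 ≤ Δ)
    (hΔ1 : Δ ≤ 1) (hs : s ∈ shadowedRicianDomain m w (K * (1 + Δ))) (l : ℕ) :
    ∫ φ, shadowedRicianTerm m w (specularRatio K Δ φ) l s ∂(uniformPhase.prod uniformPhase)
      = (ascPochhammer ℂ l).eval (m : ℂ) / (l.factorial : ℂ)
        * (K ^ l / twoRayDenominator m w K Δ s ^ (m + l : ℂ))
        * hypergeometricMixture (m + l) Δ l (twoRayArgument m w K Δ s) := by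
  simp_rw [shadowedRicianTerm_specularRatio hm hK0 hΔ0 hΔ1 hs l]
  rw [integral_const_mul, integral_affine_phaseAlignment_pow_mul_cpow _ Δ l
    (one_sub_twoRayArgument_mem_slitPlane hm hK0 hΔ0 hΔ1 hs)]

/-- The closed form of the generalized moment generating function `E[γⁿ e^{sγ}]` of the two-ray
power `γ` in terms of the diffuse power `w`. -/
noncomputable def twoRayGmgf (m w K Δ : ℝ) (n : ℕ) (s : ℂ) : ℂ :=
  n.factorial * (w : ℂ) ^ n * (m : ℂ) ^ (m : ℂ) * (1 - w * s) ^ (m - n - 1 : ℂ)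
    * ∑ l ∈ Finset.range (n + 1), n.choose l *
      ((ascPochhammer ℂ l).eval (m : ℂ) / (l.factorial : ℂ)
        * (K ^ l / twoRayDenominator m w K Δ s ^ (m + l : ℂ))
        * hypergeometricMixture (m + l) Δ l (twoRayArgument m w K Δ s))

theorem integral_shadowedRicianGmgf_specularRatio (hm : 0 < m) (hK0 : 0 ≤ K) (hΔ0 : 0 ≤ Δ)
    (hΔ1 : Δ ≤ 1) (hs : s ∈ shadowedRicianDomain m w (K * (1 + Δ))) (n : ℕ) :
    ∫ φ, shadowedRicianGmgf m w (specularRatio K Δ φ) n s ∂(uniformPhase.prod uniformPhase)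
      = twoRayGmgf m w K Δ n s := by
  simp_rw [shadowedRicianGmgf]
  rw [integral_const_mul, integral_finsetSum _ fun l _ =>
    (integrable_shadowedRicianTerm_specularRatio hm hK0 hΔ0 hΔ1 hs l).const_mul _]
  simp_rw [integral_const_mul, integral_shadowedRicianTerm_specularRatio hm hK0 hΔ0 hΔ1 hs,
    twoRayGmgf]

variable {γbar : ℝ}

theorem mem_shadowedRicianDomain_of_mean (hK0 : 0 ≤ K) (hγbar : γbar = w * (1 + K))
    (hs : (m + K + K * Δ) * γbar * s.re < m * (1 + K)) :
    s ∈ shadowedRicianDomain m w (K * (1 + Δ)) := by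
  rw [hγbar] at hs
  refine lt_of_mul_lt_mul_right (a := 1 + K) ?_ (by positivity)
  linarith

theorem mean_sub_eq_mul_twoRayDenominator (hγbar : γbar = w * (1 + K)) :
    m * (1 + K) - (m + K - K * Δ) * γbar * s = (1 + K) * twoRayDenominator m w K Δ s := by
  rw [hγbar, twoRayDenominator]
  push_cast
  ring

theorem div_mean_sub_eq_twoRayArgument (hK0 : 0 ≤ K) (hγbar : γbar = w * (1 + K)) :
    2 * K * Δ * γbar * s / (m * (1 + K) - (m + K - K * Δ) * γbar * s)
      = twoRayArgument m w K Δ s := by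
  have hc : (1 + K : ℂ) ≠ 0 := by exact_mod_cast (by positivity : 1 + K ≠ 0)
  have hnum : (2 * K * Δ * γbar * s : ℂ) = (1 + K) * (2 * K * Δ * (w * s)) := by
    rw [hγbar]
    push_cast
    ring
  rw [mean_sub_eq_mul_twoRayDenominator hγbar, hnum, mul_div_mul_left _ _ hc, twoRayArgument]

theorem ofReal_ascPochhammer_eval (l : ℕ) (m : ℝ) :
    (((ascPochhammer ℝ l).eval m : ℝ) : ℂ) = (ascPochhammer ℂ l).eval (m : ℂ) := by
  rw [ascPochhammer_eval₂ Complex.ofRealHom]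
  exact (Polynomial.eval₂_at_apply Complex.ofRealHom m).symm

theorem twoRayGmgf_eq_of_mean (hm : 0 < m) (hK0 : 0 ≤ K) (hΔ0 : 0 ≤ Δ) (hΔ1 : Δ ≤ 1)
    (hγbar : γbar = w * (1 + K)) (hs : s ∈ shadowedRicianDomain m w (K * (1 + Δ))) (n : ℕ) :
    twoRayGmgf m w K Δ n s
      = n.factorial * m ^ (m : ℂ) * (1 + K - γbar * s) ^ (m - n - 1 : ℂ) * γbar ^ n
        * ∑ l ∈ Finset.range (n + 1),
            n.choose l * ((ascPochhammer ℝ l).eval m : ℝ) / l.factorial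
              * ((1 + K) ^ (l + 1) * K ^ l
                / (m * (1 + K) - (m + K - K * Δ) * γbar * s) ^ (m + l : ℂ))
              * hypergeometricMixture (m + l) Δ l (2 * K * Δ * γbar * s
                / (m * (1 + K) - (m + K - K * Δ) * γbar * s)) := by
  have hc : 0 < (1 + K : ℂ).re := by
    simp only [Complex.add_re, Complex.one_re, Complex.ofReal_re]
    positivity
  have hc0 : (1 + K : ℂ) ≠ 0 := Complex.ne_zero_of_re_pos hc
  have hd := re_one_sub_mul_pos_of_mem_domain hm (by positivity) hs
  have hD := re_twoRayDenominator_pos hm hK0 hΔ0 hΔ1 hs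
  have hrate : (1 + K - γbar * s : ℂ) = (1 + K) * (1 - w * s) := by
    rw [hγbar]
    push_cast
    ring
  rw [div_mean_sub_eq_twoRayArgument hK0 hγbar, mean_sub_eq_mul_twoRayDenominator hγbar, hrate,
    mul_cpow_of_re_pos hc hd, hγbar, twoRayGmgf, Finset.mul_sum, Finset.mul_sum]
  refine Finset.sum_congr rfl fun l _ => ?_
  have hpow : (1 + K : ℂ) ^ (m + l : ℂ)
      = (1 + K : ℂ) ^ (m - n - 1 : ℂ) * (1 + K) ^ n * (1 + K) ^ (l + 1) := by
    rw [mul_assoc, ← pow_add, ← Complex.cpow_natCast, ← Complex.cpow_add _ _ hc0]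
    congr 1
    push_cast
    ring
  have hcpow : (1 + K : ℂ) ^ (m - n - 1 : ℂ) ≠ 0 := by simp [Complex.cpow_eq_zero_iff, hc0]
  have hweight (x : ℂ) : (1 + K : ℂ) ^ (m - n - 1 : ℂ) * (1 + K) ^ n
      * ((1 + K) ^ (l + 1) * K ^ l / ((1 + K) ^ (m + l : ℂ) * x)) = K ^ l / x := by
    rw [hpow, ← mul_div_assoc, ← mul_assoc, mul_div_mul_left]
    exact mul_ne_zero (mul_ne_zero hcpow (pow_ne_zero _ hc0)) (pow_ne_zero _ hc0)
  rw [mul_cpow_of_re_pos hc hD, ← hweight, ofReal_ascPochhammer_eval]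
  push_cast
  rw [mul_pow (w : ℂ)]
  ring

end PhaseAverage

theorem lemma1 {Ω : Type*} [MeasurableSpace Ω] (P : Measure Ω) (γ : Ω → ℝ)
    (γbar m K Δ : ℝ) (hγ : IsFTR γ γbar m K Δ P) (n : ℕ) (s : ℂ)
    (hs : (m + K + K * Δ) * γbar * s.re < m * (1 + K)) :
    Integrable (fun ω => (γ ω : ℂ) ^ n * Complex.exp (s * γ ω)) P ∧
    gmgf γ P n s =
      (n.factorial : ℂ) * (m : ℂ) ^ (m : ℂ)
        * (1 + K - γbar * s : ℂ) ^ ((m : ℂ) - n - 1) * (γbar : ℂ) ^ n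
        * ∑ l ∈ Finset.range (n + 1),
            (n.choose l : ℂ) * (((ascPochhammer ℝ l).eval m : ℝ) : ℂ) / (l.factorial : ℂ)
              * ((1 + K : ℂ) ^ (l + 1) * (K : ℂ) ^ l
                  / (m * (1 + K) - (m + K - K * Δ) * γbar * s : ℂ) ^ ((m : ℂ) + l))
              * ∑ q ∈ Finset.range (l + 1),
                  (l.choose q : ℂ) * (1 - Δ : ℂ) ^ (l - q) * (2 * Δ : ℂ) ^ q
                    * ((Real.Gamma (1 / 2 + q) / (Real.sqrt Real.pi * Real.Gamma (q + 1)) : ℝ) : ℂ)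
                    * gaussHypergeometric (m + l) (1 / 2 + q) (q + 1)
                        (2 * K * Δ * γbar * s
                          / (m * (1 + K) - (m + K - K * Δ) * γbar * s)) := by
  obtain ⟨V₁, V₂, v, hv, hK0, hK, hΔ, hγbar, hid⟩ := exists_identDistrib_twoRayPower_of_isFTR hγ
  obtain ⟨hm, hΔ0, hΔ1, -⟩ := hγ
  have hdom := mem_shadowedRicianDomain_of_mean hK0 hγbar hs
  have hidf := hid.comp (u := fun x : ℝ => (x : ℂ) ^ n * Complex.exp (s * x)) (by fun_prop)
  refine ⟨hidf.integrable_iff.2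
    (integrable_pow_mul_cexp_twoRayPower hm hv hK0 hK hΔ0 hΔ1 hΔ hdom n), ?_⟩
  have hgmgf : gmgf γ P n s = twoRayGmgf m (2 * v) K Δ n s := calc
    gmgf γ P n s
      = ∫ p, (twoRayPower V₁ V₂ p : ℂ) ^ n * Complex.exp (s * twoRayPower V₁ V₂ p)
          ∂(twoRayLaw m v) := hidf.integral_eq
    _ = ∫ φ, shadowedRicianGmgf m (2 * v) (specularRatio K Δ φ) n s
          ∂(uniformPhase.prod uniformPhase) :=
        integral_pow_mul_cexp_twoRayPower hm hv hK0 hK hΔ0 hΔ1 hΔ hdom n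
    _ = twoRayGmgf m (2 * v) K Δ n s :=
        integral_shadowedRicianGmgf_specularRatio hm hK0 hΔ0 hΔ1 hdom n
  exact hgmgf.trans (twoRayGmgf_eq_of_mean hm hK0 hΔ0 hΔ1 hγbar hdom n)
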